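/- Let $b,c\ge 0$ be integers and let $q_1,\dots,q_c\in(0,1)$. A plane partition is a matrix $\pi=(\pi_{ij})_{i,j\ge1}$ of nonnegative integers with finitely many nonzero entries such that $\pi_{ij}\ge\pi_{i+1,j}$ and $\pi_{ij}\ge\pi_{i,j+1}$ for all $i,j$. Its shape is the Young diagram $\{(i,j):\pi_{ij}>0\}$, whose row lengths form a partition $\lambda=(\lambda_1\ge\lambda_2\ge\cdots)$, and its descent set is $\mathrm{Des}(\pi)=\{(i,j):\pi_{ij}>\pi_{i+1,j}\}$. Let $\mathrm{PP}(\infty,b,c)$ be the set of plane partitions with at most $b$ nonzero rows and all entries at most $c$. The $g$-measure is the probability measure on $\mathrm{PP}(\infty,b,c)$ given by $$\mathrm P_{g,b,c}(\pi)=\frac1{Z_{b,c}}\prod_{(i,j)\in\mathrm{Des}(\pi)}q_{\pi_{ij}},\qquad Z_{b,c}=\sum_{\pi\in\mathrm{PP}(\infty,b,c)}\ \prod_{(i,j)\in\mathrm{Des}(\pi)}q_{\pi_{ij}}.$$ Then the sum defining $Z_{b,c}$ converges, $Z_{b,c}=\prod_{i=1}^c(1-q_i)^{-b}$ (so that $\mathrm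 P_{g,b,c}$ is indeed a probability measure), and for every integer $a\ge0$ $$\mathrm P_{g,b,c}(\lambda_1\le a)=\frac1{Z_{b,c}}\,s_{(a^b)}(\underbrace{1,\dots,1}_{b},q_1,\dots,q_c),$$ where $s_{(a^b)}$ is the Schur polynomial, in $b+c$ variables, of the rectangular partition with $b$ parts equal to $a$. Moreover, for every integer $a\ge0$, $$\mathrm P_{g,b,c}(\lambda_1\le a)=\frac1{Z_{b,c}}\det\left[\hat\varphi_{i-j}\right]_{i,j=1}^a,\qquad \hat\varphi_k=\sum_{\ell\ge0}\binom{b}{\ell+k}e_\ell(q_1,\dots,q_c)\quad(k\in\mathbb Z),$$ where $e_\ell$ is the $\ell$-th elementary symmetric polynomial and $\binom{b}{m}=0$ for $m<0$; equivalently, for every complex $z\neq0$, $$\sum_{k\in\mathbb Z}\hat\varphi_k z^k=(1+z)^b\prod_{i=1}^c(1+q_iz^{-1}).$$ -/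

import Mathlib

open MeasureTheory
open scoped ENNReal

noncomputable section

/-- A plane partition: a matrix of natural numbers with finitely many nonzero entries that is weakly
decreasing along rows and down columns. Rows and columns are indexed from `0`. -/
@[ext]
structure PlanePartition where
  entry : ℕ → ℕ → ℕ
  col_le : ∀ i j, entry (i + 1) j ≤ entry i j
  row_le : ∀ i j, entry i (j + 1) ≤ entry i j
  finite_support : {p : ℕ × ℕ | 0 < entry p.1 p.2}.Finite

namespace PlanePartition

/-- The shape `sh(π) = {(i,j) : π_{ij} > 0}`, as a Young diagram. -/
def shape (π : PlanePartition) : YoungDiagram where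
  cells := π.finite_support.toFinset
  isLowerSet := by
    rintro ⟨i, j⟩ ⟨i', j'⟩ ⟨hi, hj⟩ h
    simp only [Set.Finite.coe_toFinset, Set.mem_ofPred_eq] at h ⊢
    have h1 : π.entry i j ≤ π.entry i' j :=
      antitone_nat_of_succ_le (f := fun k => π.entry k j) (fun k => π.col_le k j) hi
    have h2 : π.entry i' j ≤ π.entry i' j' :=
      antitone_nat_of_succ_le (f := fun k => π.entry i' k) (fun k => π.row_le i' k) hj
    exact h.trans_le (h1.trans h2)

/-- The descent set `Des(π) = {(i,j) : π_{ij} > π_{i+1,j}}`; such cells lie in the shape. -/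
def des (π : PlanePartition) : Finset (ℕ × ℕ) :=
  π.shape.cells.filter fun p => π.entry (p.1 + 1) p.2 < π.entry p.1 p.2

theorem mem_des (π : PlanePartition) (p : ℕ × ℕ) :
    p ∈ π.des ↔ π.entry (p.1 + 1) p.2 < π.entry p.1 p.2 := by
  simp only [des, shape, Finset.mem_filter, Set.Finite.mem_toFinset, Set.mem_ofPred_eq,
    and_iff_right_iff_imp]
  omega

/-- The length `λ₁` of the first row of the shape `λ` of `π`. -/
def lambda1 (π : PlanePartition) : ℕ := π.shape.rowLen 0

end PlanePartition

/-- `PP(∞, b, c)`: plane partitions with at most `b` rows and all entries at most `c`. -/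
@[ext]
structure PP (b c : ℕ) extends PlanePartition where
  rows_le : toPlanePartition.shape.colLen 0 ≤ b
  entry_le : ∀ i j, entry i j ≤ c

/-- `PP(∞, b, c)` is a discrete space: all subsets are measurable. -/
instance (b c : ℕ) : MeasurableSpace (PP b c) := ⊤

/-- The entry of `π` at a descent, an element of `{1, …, c}`, as the (`0`-based) index of the
corresponding parameter among `q_1, …, q_c`. -/
def PP.level {b c : ℕ} (π : PP b c) (p : π.des) : Fin c :=
  ⟨π.entry p.1.1 p.1.2 - 1, by
    have h1 := (π.mem_des p.1).1 p.2
    have h2 := π.entry_le p.1.1 p.1.2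
    omega⟩

/-- The unnormalized weight `∏_{(i,j) ∈ Des(π)} q_{π_{ij}}`. -/
def gWeight (b : ℕ) {c : ℕ} (q : Fin c → ℝ) (π : PP b c) : ℝ :=
  ∏ p : π.des, q (π.level p)

/-- The normalization constant `Z_{b,c}`. -/
def gZ (b : ℕ) {c : ℕ} (q : Fin c → ℝ) : ℝ := ∑' π : PP b c, gWeight b q π

/-- The `g`-measure: `π` has mass `Z_{b,c}⁻¹ ∏_{(i,j) ∈ Des(π)} q_{π_{ij}}`. -/
def gMeasure (b : ℕ) {c : ℕ} (q : Fin c → ℝ) : Measure (PP b c) :=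
  Measure.sum fun π => ENNReal.ofReal (gWeight b q π / gZ b q) • Measure.dirac π

/-- Semistandard Young tableaux of shape `μ` with entries in `{0, …, n - 1}`. -/
abbrev BoundedSSYT (μ : YoungDiagram) (n : ℕ) : Type :=
  {T : SemistandardYoungTableau μ // ∀ p ∈ μ.cells, T p.1 p.2 < n}

instance (μ : YoungDiagram) (n : ℕ) : Finite (BoundedSSYT μ n) := by
  refine Finite.of_injective
    (fun (T : BoundedSSYT μ n) (p : μ.cells) => (⟨T.1 p.1.1 p.1.2, T.2 p.1 p.2⟩ : Fin n)) ?_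
  intro T T' h
  apply Subtype.ext
  apply SemistandardYoungTableau.ext
  intro i j
  by_cases hij : (i, j) ∈ μ
  · have := congrFun h ⟨(i, j), (YoungDiagram.mem_cells _).2 hij⟩
    simpa using this
  · rw [T.1.zeros hij, T'.1.zeros hij]

instance (μ : YoungDiagram) (n : ℕ) : Fintype (BoundedSSYT μ n) := Fintype.ofFinite _

/-- The Schur polynomial `s_μ(x_0, …, x_{n-1})`. -/
def schurPoly (μ : YoungDiagram) (n : ℕ) : MvPolynomial (Fin n) ℝ :=
  ∑ T : BoundedSSYT μ n, ∏ p : μ.cells, MvPolynomial.X ⟨T.1 p.1.1 p.1.2, T.2 p.1 p.2⟩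

/-- The rectangular partition `(a^b)`: `b` rows of length `a`. -/
def rectDiagram (a b : ℕ) : YoungDiagram where
  cells := Finset.range b ×ˢ Finset.range a
  isLowerSet := by
    rintro ⟨i, j⟩ ⟨i', j'⟩ ⟨hi, hj⟩ h
    simp only [Finset.coe_product, Finset.coe_range, Set.mem_prod, Set.mem_Iio] at h hi hj ⊢
    omega

/-- The binomial coefficient `b.choose m` for an integer `m`; it vanishes for negative `m`. -/
def intChoose (b : ℕ) (m : ℤ) : ℕ := if 0 ≤ m then b.choose m.toNat else 0

/-- `φ̂_k = ∑_{ℓ ≥ 0} (b choose ℓ + k) e_ℓ(q_1, …, q_c)`; the terms with `ℓ > c` vanish. -/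
def phiHat (b : ℕ) {c : ℕ} (q : Fin c → ℝ) (k : ℤ) : ℝ :=
  ∑ l ∈ Finset.range (c + 1),
    (intChoose b (l + k) : ℝ) * MvPolynomial.eval q (MvPolynomial.esymm (Fin c) ℝ l)

end

/-! Cut `π` into its level sets. If `π` has at most `a` columns, the heights of the columns of `{π >
k}`, for `0 ≤ k ≤ c`, form a chain of decreasing sequences in `{0, …, b}^a` that shrinks to `0`. A
column has at most one descent with entry `k + 1`, and has one exactly when its height drops between
levels `k` and `k + 1`; hence the weight of `π` is a product of one-step weights
(`PP.gWeight_eq_prod_levels`), and the sum over `π` is a composition of transfer operators.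

These operators act simply on determinants. By `sum_stepWeight_mul_alternating`, summing each row
over the interval allowed by its neighbour creates a boundary term proportional to the next row,
which the alternating form kills. For the rows `[X^(l+j-i)] P (1 + X)^l`, a step of parameter `x`
therefore just replaces `P` by `P (1 + xX)`. The end condition `l = 0` is the determinant for `P =
(1 + X)⁻¹`, and the free sum over the initial sequence is one more step, with `x = 1`, from the
constant sequence `b`. What results is the determinant with entries `[X^(b+j-i)] (1 + X)^b ∏ (1 +
q_k X)`.

Semistandard tableaux of shape `(a^b)`, with entries complemented, are the chains that start at the
full rectangle and lower each column by at most one per step. The same mechanism, with rows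
`[X^(l+j-i)] P`, gives the dual Jacobi–Trudi formula `eval_schurPoly_rectDiagram`. At the variables
`1^b, q` it is the determinant above, and the symmetry of binomial coefficients turns its entries
into `phiHat`.

For `Z`, counting descents by row and entry is a bijection from plane partitions to `b × c` matrices
of natural numbers, the inverse being a last passage recursion. The weight becomes a product of
independent geometric weights. -/

/-! ### Transfer operators on decreasing sequences and determinants -/

/-- The first term of a finite sequence, or `0` if the sequence is empty. -/
def headOrZero {a b : ℕ} (m : Fin a → Fin (b + 1)) : Fin (b + 1) :=
  if h : 0 < a then m ⟨0, h⟩ else 0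

theorem antitone_cons_iff {a b : ℕ} (t : Fin (b + 1)) (m : Fin a → Fin (b + 1)) :
    Antitone (Fin.cons t m : Fin (a + 1) → Fin (b + 1)) ↔ headOrZero m ≤ t ∧ Antitone m := by
  cases a with
  | zero => simp [headOrZero, Subsingleton.antitone]
  | succ a =>
    have := antitone_vecCons (f := m) (a := t)
    simpa [headOrZero, Matrix.vecCons] using this

/-- The weight `∏ κ(lᵢ, mᵢ)` of a step from `l` to a decreasing sequence `m ≤ l`. -/
noncomputable def stepWeight {a b : ℕ} (κ : ℕ → ℕ → ℝ) (l m : Fin a → Fin (b + 1)) : ℝ :=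
  open Classical in if Antitone m ∧ ∀ i, m i ≤ l i then ∏ i, κ (l i) (m i) else 0

theorem stepWeight_cons {a b : ℕ} (κ : ℕ → ℕ → ℝ) (l₀ t : Fin (b + 1))
    (l m : Fin a → Fin (b + 1)) :
    stepWeight κ (Fin.cons l₀ l : Fin (a + 1) → Fin (b + 1)) (Fin.cons t m) =
      (if headOrZero m ≤ t ∧ t ≤ l₀ then κ l₀ t else 0) * stepWeight κ l m := by
  simp only [stepWeight, antitone_cons_iff, Fin.forall_fin_succ, Fin.cons_zero, Fin.cons_succ,
    Fin.prod_univ_succ]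
  by_cases h1 : headOrZero m ≤ t <;> by_cases h2 : t ≤ l₀ <;> by_cases h3 : Antitone m <;>
    simp [h1, h2, h3]

theorem headOrZero_le_headOrZero {a b : ℕ} {l m : Fin a → Fin (b + 1)} (h : ∀ i, m i ≤ l i) :
    headOrZero m ≤ headOrZero l := by
  unfold headOrZero
  split_ifs
  · exact h _
  · exact le_rfl

theorem sum_fin_between {b : ℕ} {V : Type*} [AddCommMonoid V] (g : ℕ → V) (s l : Fin (b + 1)) :
    ∑ t : Fin (b + 1), (if s ≤ t ∧ t ≤ l then g t else 0) =
      ∑ t ∈ Finset.Icc (s : ℕ) l, g t := by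
  have h := Fin.sum_univ_eq_sum_range
    (fun t : ℕ => if (s : ℕ) ≤ t ∧ t ≤ l then g t else 0) (b + 1)
  simp only [Fin.le_def]
  rw [h, ← Finset.sum_filter]
  refine Finset.sum_congr ?_ fun _ _ => rfl
  ext t
  have := l.2
  simp only [Finset.mem_filter, Finset.mem_range, Finset.mem_Icc]
  omega

/-- If, up to multiples of `v (k + 1) s`, summing `v k` over `[s, l]` against `κ l` gives
`v k l + x • v (k + 1) l`, then the transfer operator of `κ` replaces `v k` by
`v k + x • v (k + 1)` in the rows of an alternating form. -/
theorem sum_stepWeight_mul_alternating {b : ℕ} {V : Type*} [AddCommGroup V] [Module ℝ V]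
    (κ : ℕ → ℕ → ℝ) (x : ℝ) (a : ℕ) (v : ℕ → ℕ → V)
    (hκ : ∀ k s l, s ≤ l → ∃ γ : ℝ, ∑ t ∈ Finset.Icc s l, κ l t • v k t =
      v k l + x • v (k + 1) l + γ • v (k + 1) s)
    (h0 : v a 0 = 0) (f : V [⋀^Fin a]→ₗ[ℝ] ℝ) (l : Fin a → Fin (b + 1)) (hl : Antitone l) :
    ∑ m : Fin a → Fin (b + 1), stepWeight κ l m * f (fun i => v i (m i)) =
      f (fun i => v i (l i) + x • v (i + 1) (l i)) := by
  induction a generalizing v with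
  | zero =>
    simp [stepWeight, Subsingleton.antitone]
    congr 1
    exact Subsingleton.elim _ _
  | succ a ih =>
    obtain ⟨l₀, l, rfl⟩ : ∃ l₀ l', l = Fin.cons l₀ l' := ⟨l 0, Fin.tail l, by simp⟩
    obtain ⟨hl0, hl⟩ := (antitone_cons_iff _ _).1 hl
    rw [← (Fin.consEquiv fun _ => Fin (b + 1)).sum_comp, Fintype.sum_prod_type, Finset.sum_comm]
    have key : ∀ m : Fin a → Fin (b + 1),
        ∑ t : Fin (b + 1), stepWeight κ (Fin.cons l₀ l : Fin (a + 1) → Fin (b + 1))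
          (Fin.cons t m) * f (fun i => v i ((Fin.cons t m : Fin (a + 1) → Fin (b + 1)) i)) =
        stepWeight κ l m * (f.curryLeft (v 0 l₀ + x • v 1 l₀)) (fun i => v (i + 1) (m i)) := by
      intro m
      by_cases hm : stepWeight κ l m = 0
      · simp [stepWeight_cons, hm]
      have hml : ∀ i, m i ≤ l i := by
        by_contra hc
        exact hm (if_neg fun h => hc h.2)
      have hs : ((headOrZero m : Fin (b + 1)) : ℕ) ≤ l₀ :=
        (headOrZero_le_headOrZero hml).trans hl0
      have hrow : ∀ t : Fin (b + 1),
          f (fun i => v i ((Fin.cons t m : Fin (a + 1) → Fin (b + 1)) i)) =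
            f.curryLeft (v 0 t) (fun i => v (i + 1) (m i)) := by
        intro t
        rw [AlternatingMap.curryLeft_apply_apply]
        congr 1
        funext i
        refine Fin.cases ?_ (fun i => ?_) i <;> simp
      obtain ⟨γ, hγ⟩ := hκ 0 _ _ hs
      -- The boundary term puts `v 1 (m 0)` in row `0`, which already stands in row `1`. If no row
      -- follows, `headOrZero` is `0` and the term vanishes by `h0`.
      have hvan :
          f.curryLeft (v 1 (headOrZero m : Fin (b + 1))) (fun i => v (i + 1) (m i)) = 0 := by
        rw [AlternatingMap.curryLeft_apply_apply]
        cases a with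
        | zero =>
          refine f.map_coord_zero 0 ?_
          simpa [headOrZero] using h0
        | succ a =>
          refine f.map_eq_zero_of_eq _ (i := 0) (j := 1) ?_ (by simp)
          simp [headOrZero]
      -- With the other rows fixed, the form is a linear functional of its first row, so the sum
      -- over `t` can be taken inside.
      obtain ⟨φ, hφ⟩ : ∃ φ : V →ₗ[ℝ] ℝ, ∀ y,
          f.curryLeft y (fun i => v (i + 1) (m i)) = φ y :=
        ⟨{ toFun := fun y => f.curryLeft y (fun i => v (i + 1) (m i))
           map_add' := fun y z => by rw [map_add]; rfl
           map_smul' := fun r y => by rw [map_smul]; rfl }, fun _ => rfl⟩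
      simp only [stepWeight_cons, hrow, hφ] at hvan ⊢
      have hsum := sum_fin_between (fun t => κ l₀ t • v 0 t) (headOrZero m) l₀
      rw [hγ] at hsum
      have hφsum := congrArg φ hsum
      simp only [map_sum, zero_add, map_add, map_smul, hvan, smul_zero, add_zero] at hφsum
      rw [map_add, map_smul, ← hφsum, Finset.mul_sum]
      refine Finset.sum_congr rfl fun t _ => ?_
      split_ifs
      · simp only [map_smul, smul_eq_mul]
        ring
      · simp
    refine (Finset.sum_congr rfl fun m _ => key m).trans ?_
    rw [ih (fun k => v (k + 1)) (fun k => hκ (k + 1)) h0 _ l hl,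
      AlternatingMap.curryLeft_apply_apply]
    congr 1
    funext i
    refine Fin.cases ?_ (fun i => ?_) i <;> simp

/-- Summation over chains `M 0, …, M n` by successive application of transfer operators. -/
theorem sum_chain {S : Type*} [Fintype S] (good : S → Prop) (n : ℕ) (w : Fin n → S → S → ℝ)
    (G : Fin (n + 1) → S → ℝ) (u : S → ℝ) (hw : ∀ k l m, w k l m ≠ 0 → good m)
    (hu : ∀ l, u l ≠ 0 → good l)
    (hG : ∀ k l, good l → ∑ m, w k l m * G k.succ m = G k.castSucc l) :
    ∑ M : Fin (n + 1) → S, u (M 0) * (∏ k, w k (M k.castSucc) (M k.succ)) * G (Fin.last n)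
      (M (Fin.last n)) = ∑ l, u l * G 0 l := by
  induction n generalizing u with
  | zero =>
    rw [← (Equiv.funUnique (Fin 1) S).symm.sum_comp]
    simp
  | succ n ih =>
    rw [← (Fin.consEquiv fun _ => S).sum_comp, Fintype.sum_prod_type]
    refine Finset.sum_congr rfl fun l _ => ?_
    by_cases hl : u l = 0
    · simp [hl]
    have := ih (fun k => w k.succ) (fun k => G k.succ) (w 0 l) (fun k => hw k.succ) (hw 0 l)
      (fun k => hG k.succ)
    have h2 := hG 0 l (hu l hl)
    simp only [Fin.succ_zero_eq_one, Fin.castSucc_zero] at h2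
    rw [Fin.succ_zero_eq_one, h2] at this
    rw [← this, Finset.mul_sum]
    refine Finset.sum_congr rfl fun M _ => ?_
    simp only [Fin.consEquiv_apply, Fin.prod_univ_succ, Fin.cons_zero, Fin.castSucc_zero,
      Fin.cons_succ, ← Fin.succ_castSucc, ← Fin.succ_last]
    ring

/-! ### The two families of determinant rows and their step identities -/

open PowerSeries in
/-- The rows `j ↦ [Xˡ⁺ʲ⁻ⁱ] P (1 + X)ˡ` of the determinant of a dual Grothendieck polynomial. -/
noncomputable def grothendieckRow (a : ℕ) (P : PowerSeries ℝ) (i l : ℕ) : Fin a → ℝ :=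
  fun j => coeff (l + j) (X ^ i * (P * (1 + X) ^ l))

open PowerSeries in
/-- The rows `j ↦ [Xˡ⁺ʲ⁻ⁱ] P` of the dual Jacobi–Trudi determinant. -/
noncomputable def jacobiTrudiRow (a : ℕ) (P : PowerSeries ℝ) (i l : ℕ) : Fin a → ℝ :=
  fun j => coeff (l + j) (X ^ i * P)

/-- Each entry that moves has weight `x`. -/
def jumpKernel (x : ℝ) (l t : ℕ) : ℝ := if t < l then x else 1

/-- Each entry moves by at most one, with weight `x` if it moves. -/
def stripKernel (x : ℝ) (l t : ℕ) : ℝ := if t < l then (if l ≤ t + 1 then x else 0) else 1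

section Rows

open PowerSeries

variable {a : ℕ} (P : PowerSeries ℝ) (x : ℝ)

theorem grothendieckRow_succ (i l : ℕ) :
    grothendieckRow a P (i + 1) (l + 1) =
      grothendieckRow a P (i + 1) l + grothendieckRow a P i l := by
  funext j
  simp only [grothendieckRow, Pi.add_apply]
  have h1 : (X ^ (i + 1) * (P * (1 + X) ^ (l + 1)) : PowerSeries ℝ) =
      X * (X ^ (i + 1) * (P * (1 + X) ^ l) + X ^ i * (P * (1 + X) ^ l)) := by ring
  rw [h1, show l + 1 + (j : ℕ) = (l + j) + 1 by ring, coeff_succ_X_mul, map_add]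

theorem jacobiTrudiRow_succ (i l : ℕ) :
    jacobiTrudiRow a P (i + 1) (l + 1) = jacobiTrudiRow a P i l := by
  funext j
  simp only [jacobiTrudiRow]
  rw [pow_succ', mul_assoc, show l + 1 + (j : ℕ) = (l + j) + 1 by ring, coeff_succ_X_mul]

/-- The columns stop at `j < a`, so the factor `X ^ a` leaves nothing. This is the boundary
condition below the last row. -/
theorem grothendieckRow_self_zero : grothendieckRow a P a 0 = 0 := by
  funext j
  simp [grothendieckRow, coeff_X_pow_mul', j.2]

theorem jacobiTrudiRow_self_zero : jacobiTrudiRow a P a 0 = 0 := by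
  funext j
  simp [jacobiTrudiRow, coeff_X_pow_mul', j.2]

theorem grothendieckRow_mul (i l : ℕ) :
    grothendieckRow a (P * (1 + C x * X)) i l =
      grothendieckRow a P i l + x • grothendieckRow a P (i + 1) l := by
  funext j
  simp only [grothendieckRow, Pi.add_apply, Pi.smul_apply, smul_eq_mul]
  have h1 : (X ^ i * (P * (1 + C x * X) * (1 + X) ^ l) : PowerSeries ℝ) =
      X ^ i * (P * (1 + X) ^ l) + C x * (X ^ (i + 1) * (P * (1 + X) ^ l)) := by ring
  rw [h1, map_add, coeff_C_mul]

theorem jacobiTrudiRow_mul (i l : ℕ) :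
    jacobiTrudiRow a (P * (1 + C x * X)) i l =
      jacobiTrudiRow a P i l + x • jacobiTrudiRow a P (i + 1) l := by
  funext j
  simp only [jacobiTrudiRow, Pi.add_apply, Pi.smul_apply, smul_eq_mul]
  have h1 : (X ^ i * (P * (1 + C x * X)) : PowerSeries ℝ) =
      X ^ i * P + C x * (X ^ (i + 1) * P) := by ring
  rw [h1, map_add, coeff_C_mul]

/-- Row `k` at `t` is the difference of row `k + 1` at `t + 1` and at `t`, so the terms with `t < l`
telescope. -/
theorem sum_jumpKernel_smul_grothendieckRow (k s l : ℕ) (h : s ≤ l) :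
    ∑ t ∈ Finset.Icc s l, jumpKernel x l t • grothendieckRow a P k t =
      grothendieckRow a P k l + x • grothendieckRow a P (k + 1) l +
        (-x) • grothendieckRow a P (k + 1) s := by
  have tele : ∑ t ∈ Finset.Ico s l, grothendieckRow a P k t =
      grothendieckRow a P (k + 1) l - grothendieckRow a P (k + 1) s := by
    induction l, h using Nat.le_induction with
    | base => simp
    | succ l hl ih => rw [Finset.sum_Ico_succ_top hl, ih, grothendieckRow_succ]; abel
  rw [← Finset.Ico_insert_right h, Finset.sum_insert (by simp)]
  have : ∑ t ∈ Finset.Ico s l, jumpKernel x l t • grothendieckRow a P k t =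
      ∑ t ∈ Finset.Ico s l, x • grothendieckRow a P k t :=
    Finset.sum_congr rfl fun t ht => by simp [jumpKernel, (Finset.mem_Ico.1 ht).2]
  rw [this, ← Finset.smul_sum, tele]
  simp only [jumpKernel, lt_irrefl, if_false, one_smul, smul_sub, neg_smul]
  abel

/-- Only `t = l` and `t = l - 1` contribute, and row `k` at `l - 1` is row `k + 1` at `l`. If `s =
l`, the second term is absent, and `γ = -x` compensates for it. -/
theorem sum_stripKernel_smul_jacobiTrudiRow (k s l : ℕ) (h : s ≤ l) :
    ∃ γ : ℝ, ∑ t ∈ Finset.Icc s l, stripKernel x l t • jacobiTrudiRow a P k t =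
      jacobiTrudiRow a P k l + x • jacobiTrudiRow a P (k + 1) l +
        γ • jacobiTrudiRow a P (k + 1) s := by
  rcases h.eq_or_lt with rfl | h
  · exact ⟨-x, by simp [stripKernel]⟩
  · refine ⟨0, ?_⟩
    obtain ⟨l, rfl⟩ : ∃ l', l = l' + 1 := ⟨l - 1, by omega⟩
    rw [← Finset.Ico_insert_right h.le, Finset.sum_insert (by simp),
      Finset.sum_eq_single_of_mem l (by simp; omega)]
    · simp [stripKernel, jacobiTrudiRow_succ]
    · intro t ht htl
      have := Finset.mem_Ico.1 ht
      have h2 : ¬ l ≤ t := by omega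
      simp [stripKernel, this.2, h2]

variable {b : ℕ} (l : Fin a → Fin (b + 1))

theorem sum_stepWeight_mul_det_grothendieckRow (hl : Antitone l) :
    ∑ m : Fin a → Fin (b + 1), stepWeight (jumpKernel x) l m *
        Matrix.det (fun i => grothendieckRow a P i (m i)) =
      Matrix.det (fun i => grothendieckRow a (P * (1 + C x * X)) i (l i)) := by
  have := sum_stepWeight_mul_alternating (jumpKernel x) x a (grothendieckRow a P)
    (fun k s l h => ⟨_, sum_jumpKernel_smul_grothendieckRow P x k s l h⟩)
    (grothendieckRow_self_zero P) Matrix.detRowAlternating l hl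
  simp only [grothendieckRow_mul]
  exact this

theorem sum_stepWeight_mul_det_jacobiTrudiRow (hl : Antitone l) :
    ∑ m : Fin a → Fin (b + 1), stepWeight (stripKernel x) l m *
        Matrix.det (fun i => jacobiTrudiRow a P i (m i)) =
      Matrix.det (fun i => jacobiTrudiRow a (P * (1 + C x * X)) i (l i)) := by
  have := sum_stepWeight_mul_alternating (stripKernel x) x a (jacobiTrudiRow a P)
    (fun k s l h => sum_stripKernel_smul_jacobiTrudiRow P x k s l h)
    (jacobiTrudiRow_self_zero P) Matrix.detRowAlternating l hl
  simp only [jacobiTrudiRow_mul]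
  exact this

theorem det_eq_one_of_upper_unitriangular {M : Matrix (Fin a) (Fin a) ℝ}
    (h0 : ∀ i j, j < i → M i j = 0) (h1 : ∀ i, M i i = 1) : M.det = 1 := by
  rw [Matrix.det_of_isUpperTriangular (fun i j h => h0 i j h)]
  simp [h1]

theorem exists_pos_zero_of_antitone (hl : Antitone l) (h : l ≠ 0) :
    ∃ ha : 0 < a, 0 < ((l ⟨0, ha⟩ : Fin (b + 1)) : ℕ) := by
  obtain ⟨i, hi⟩ := Function.ne_iff.1 h
  have hi' : 0 < l i := Fin.pos_iff_ne_zero.2 hi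
  exact ⟨i.pos, hi'.trans_le (hl (Fin.le_def.2 (Nat.zero_le _)))⟩

theorem det_jacobiTrudiRow_one (hl : Antitone l) :
    Matrix.det (fun i => jacobiTrudiRow a 1 i (l i)) = if l = 0 then 1 else 0 := by
  split_ifs with h
  · subst h
    refine det_eq_one_of_upper_unitriangular (fun i j hij => ?_) fun i => ?_
    · have : ¬ (j : ℕ) = i := by have := Fin.lt_def.1 hij; omega
      simp [jacobiTrudiRow, coeff_X_pow, this]
    · simp [jacobiTrudiRow]
  · obtain ⟨ha, hpos⟩ := exists_pos_zero_of_antitone l hl h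
    refine Matrix.det_eq_zero_of_row_eq_zero ⟨0, ha⟩ fun j => ?_
    simp only [jacobiTrudiRow, pow_zero, one_mul, coeff_one]
    rw [if_neg (by omega)]

/-- If `l ≠ 0`, its first term `l₀` is positive and the top row reads coefficients of degree at
least `l₀` in `(1 + X) ^ (l₀ - 1)`, hence is zero. If `l = 0`, the matrix is upper unitriangular. -/
theorem det_grothendieckRow_inv (hl : Antitone l) {P : PowerSeries ℝ} (hP : P * (1 + X) = 1) :
    Matrix.det (fun i => grothendieckRow a P i (l i)) = if l = 0 then 1 else 0 := by
  have hP0 : constantCoeff P = 1 := by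
    have := congrArg (constantCoeff (R := ℝ)) hP
    simpa using this
  split_ifs with h
  · subst h
    refine det_eq_one_of_upper_unitriangular (fun i j hij => ?_) fun i => ?_
    · have : ¬ (i : ℕ) ≤ j := by have := Fin.lt_def.1 hij; omega
      simp [grothendieckRow, coeff_X_pow_mul', this]
    · simp [grothendieckRow, coeff_X_pow_mul', hP0]
  · obtain ⟨ha, hpos⟩ := exists_pos_zero_of_antitone l hl h
    refine Matrix.det_eq_zero_of_row_eq_zero ⟨0, ha⟩ fun j => ?_
    obtain ⟨t, ht⟩ : ∃ t, ((l ⟨0, ha⟩ : Fin (b + 1)) : ℕ) = t + 1 :=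
      ⟨(l ⟨0, ha⟩ : Fin (b + 1)) - 1, by omega⟩
    simp only [grothendieckRow, pow_zero, one_mul, ht]
    rw [pow_succ', ← mul_assoc, hP, one_mul]
    have : ((1 + X : PowerSeries ℝ) ^ t) =
        (((1 + Polynomial.X) ^ t : Polynomial ℝ) : PowerSeries ℝ) := by
      simp
    rw [this, Polynomial.coeff_coe, Polynomial.coeff_one_add_X_pow,
      Nat.choose_eq_zero_of_lt (by omega)]
    simp

end Rows

theorem stepWeight_ne_zero {a b : ℕ} {κ : ℕ → ℕ → ℝ} {l m : Fin a → Fin (b + 1)}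
    (h : stepWeight κ l m ≠ 0) : Antitone m ∧ ∀ i, m i ≤ l i := by
  by_contra hc
  exact h (if_neg hc)

/-! ### Chain sums as single determinants -/

section ChainSums

open PowerSeries

variable {a b n : ℕ} (x : Fin n → ℝ)

theorem prod_Ici_castSucc (P : PowerSeries ℝ) (k : Fin n) :
    P * ∏ j ∈ Finset.univ.filter (fun j : Fin n => (k.castSucc : ℕ) ≤ j), (1 + C (x j) * X) =
      P * (∏ j ∈ Finset.univ.filter (fun j : Fin n => (k.succ : ℕ) ≤ j), (1 + C (x j) * X)) *
        (1 + C (x k) * X) := by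
  have : Finset.univ.filter (fun j : Fin n => (k.castSucc : ℕ) ≤ j) =
      insert k (Finset.univ.filter (fun j : Fin n => (k.succ : ℕ) ≤ j)) := by
    ext j
    simp [Fin.ext_iff]
    omega
  rw [this, Finset.prod_insert (by simp)]
  ring

theorem sum_chain_det (κ : ℝ → ℕ → ℕ → ℝ) (row : PowerSeries ℝ → ℕ → ℕ → Fin a → ℝ)
    (hstep : ∀ P y (l : Fin a → Fin (b + 1)), Antitone l →
      ∑ m : Fin a → Fin (b + 1), stepWeight (κ y) l m * Matrix.det (fun i => row P i (m i)) =
        Matrix.det (fun i => row (P * (1 + C y * X)) i (l i)))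
    (P : PowerSeries ℝ) (hP : ∀ l : Fin a → Fin (b + 1), Antitone l →
      Matrix.det (fun i => row P i (l i)) = if l = 0 then 1 else 0)
    (u : (Fin a → Fin (b + 1)) → ℝ) (hu : ∀ l, u l ≠ 0 → Antitone l) :
    ∑ M : Fin (n + 1) → Fin a → Fin (b + 1), (if M (Fin.last n) = 0 then
      u (M 0) * ∏ k, stepWeight (κ (x k)) (M k.castSucc) (M k.succ) else 0) =
      ∑ l, u l * Matrix.det (fun i => row (P * ∏ k, (1 + C (x k) * X)) i (l i)) := by
  have := sum_chain (S := Fin a → Fin (b + 1)) Antitone n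
    (fun k => stepWeight (κ (x k)))
    (fun k l => Matrix.det (fun i => row (P * ∏ j ∈ Finset.univ.filter
      (fun j : Fin n => (k : ℕ) ≤ j), (1 + C (x j) * X)) i (l i))) u
    (fun k l m h => (stepWeight_ne_zero h).1) hu
    (fun k l hl => by rw [hstep _ _ _ hl, prod_Ici_castSucc])
  simp only [Fin.val_zero, Nat.zero_le, Finset.filter_true] at this
  rw [← this]
  refine Finset.sum_congr rfl fun M _ => ?_
  have hempty : Finset.univ.filter (fun j : Fin n => (Fin.last n : ℕ) ≤ j) = ∅ := by
    ext j
    simp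
  rw [hempty, Finset.prod_empty, mul_one]
  by_cases hz : u (M 0) * ∏ k, stepWeight (κ (x k)) (M k.castSucc) (M k.succ) = 0
  · simp [hz]
  have hM : Antitone (M (Fin.last n)) := by
    -- A chain without steps inherits monotonicity from `u`; otherwise the last step enforces it.
    cases n with
    | zero => exact hu _ (left_ne_zero_of_mul hz)
    | succ n =>
      have := Finset.prod_ne_zero_iff.1 (right_ne_zero_of_mul hz) (Fin.last n) (Finset.mem_univ _)
      simpa using (stepWeight_ne_zero this).1
  rw [hP _ hM]
  simp

end ChainSums

/-! ### Level sets of plane partitions -/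

/-- The conjugate of a decreasing sequence. -/
noncomputable def conjSeq (f : ℕ → ℕ) (k : ℕ) : ℕ := sInf {j | f j ≤ k}

/-- The existence hypothesis excludes the default value `sInf ∅ = 0`. -/
theorem lt_conjSeq_iff {f : ℕ → ℕ} (hf : Antitone f) {k : ℕ} (h : ∃ j, f j ≤ k) (j : ℕ) :
    j < conjSeq f k ↔ k < f j := by
  constructor
  · intro hj
    exact not_le.1 (Nat.notMem_of_lt_sInf (s := {j | f j ≤ k}) hj)
  · intro hk
    by_contra hc
    have h1 : f (conjSeq f k) ≤ k := Nat.sInf_mem h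
    exact absurd (hk.trans_le (hf (not_lt.1 hc))) (not_lt.2 h1)

namespace PP

variable {a b c : ℕ} (π : PP b c)

theorem antitone_col (j : ℕ) : Antitone fun i => π.entry i j :=
  antitone_nat_of_succ_le fun i => π.col_le i j

theorem antitone_row (i : ℕ) : Antitone (π.entry i) :=
  antitone_nat_of_succ_le fun j => π.row_le i j

theorem mem_shape (i j : ℕ) : (i, j) ∈ π.shape ↔ 0 < π.entry i j := by
  rw [← YoungDiagram.mem_cells]
  simp [PlanePartition.shape]

theorem entry_eq_zero_of_le {i : ℕ} (h : b ≤ i) (j : ℕ) : π.entry i j = 0 := by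
  by_contra hc
  have h1 : (i, j) ∈ π.shape := (π.mem_shape i j).2 (Nat.pos_of_ne_zero hc)
  have h2 := YoungDiagram.mem_iff_lt_colLen.1
    (π.shape.up_left_mem le_rfl (Nat.zero_le j) h1)
  have := π.rows_le
  omega

theorem lambda1_le_iff : π.lambda1 ≤ a ↔ ∀ i j, a ≤ j → π.entry i j = 0 := by
  constructor
  · intro h i j hj
    by_contra hc
    have h1 : (i, j) ∈ π.shape := (π.mem_shape i j).2 (Nat.pos_of_ne_zero hc)
    have h2 := YoungDiagram.mem_iff_lt_rowLen.1
      (π.shape.up_left_mem (Nat.zero_le i) le_rfl h1)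
    rw [PlanePartition.lambda1] at h
    omega
  · intro h
    by_contra hc
    have h1 := (π.mem_shape 0 a).1 (YoungDiagram.mem_iff_lt_rowLen.2 (not_le.1 hc))
    exact h1.ne' (h 0 a le_rfl)

/-- A plane partition in `PP(∞, b, c)` from its entries. -/
def ofEntry (e : ℕ → ℕ → ℕ) (hcol : ∀ i j, e (i + 1) j ≤ e i j) (hrow : ∀ i j, e i (j + 1) ≤ e i j)
    (hb : ∀ j, e b j = 0) (ha : ∃ a, e 0 a = 0) (hc : ∀ i j, e i j ≤ c) : PP b c where
  entry := e
  col_le := hcol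
  row_le := hrow
  finite_support := by
    obtain ⟨a, ha⟩ := ha
    refine (Finset.range b ×ˢ Finset.range a).finite_toSet.subset ?_
    rintro ⟨i, j⟩ hij
    have hcol' : Antitone fun i => e i j := antitone_nat_of_succ_le fun i => hcol i j
    have hrow' : Antitone (e 0) := antitone_nat_of_succ_le fun j => hrow 0 j
    have hpos : 0 < e i j := hij
    simp only [Finset.coe_product, Finset.coe_range, Set.mem_prod, Set.mem_Iio]
    constructor
    · by_contra h
      have : e i j ≤ e b j := hcol' (not_lt.1 h)
      rw [hb] at this
      omega
    · by_contra h
      have h1 : e 0 j ≤ e 0 a := hrow' (not_lt.1 h)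
      have h2 : e i j ≤ e 0 j := hcol' (Nat.zero_le i)
      omega
  rows_le := by
    by_contra h
    have h1 := YoungDiagram.mem_iff_lt_colLen.2 (not_le.1 h)
    rw [← YoungDiagram.mem_cells] at h1
    simp [PlanePartition.shape, hb] at h1
  entry_le := hc

theorem entry_injective {π π' : PP b c} (h : ∀ i j, π.entry i j = π'.entry i j) : π = π' := by
  apply PP.ext
  funext i j
  exact h i j

/-- The number of entries exceeding `k` in column `j`. -/
noncomputable def colHeight (k j : ℕ) : ℕ := conjSeq (fun i => π.entry i j) k

theorem lt_colHeight_iff (i j k : ℕ) : i < π.colHeight k j ↔ k < π.entry i j :=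
  lt_conjSeq_iff (π.antitone_col j) ⟨b, by simp [π.entry_eq_zero_of_le le_rfl]⟩ i

theorem colHeight_le (k j : ℕ) : π.colHeight k j ≤ b := by
  by_contra h
  have := (π.lt_colHeight_iff b j k).1 (not_le.1 h)
  simp [π.entry_eq_zero_of_le le_rfl] at this

/-- The column heights of the level sets, as a chain of decreasing sequences. -/
noncomputable def levels (a : ℕ) (k : Fin (c + 1)) (j : Fin a) : Fin (b + 1) :=
  ⟨π.colHeight k j, Nat.lt_succ_of_le (π.colHeight_le k j)⟩

theorem levels_antitone (k : Fin (c + 1)) : Antitone (π.levels a k) := by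
  intro j j' h
  by_contra hc
  have h1 : π.colHeight k j < π.colHeight k j' := not_le.1 hc
  have h2 := (π.lt_colHeight_iff _ _ _).1 h1
  have h3 : π.entry (π.colHeight k j) j' ≤ π.entry (π.colHeight k j) j := π.antitone_row _ h
  exact lt_irrefl _ ((π.lt_colHeight_iff _ _ _).2 (h2.trans_le h3))

theorem colHeight_succ_le (k j : ℕ) : π.colHeight (k + 1) j ≤ π.colHeight k j := by
  by_contra hc
  have h2 := (π.lt_colHeight_iff _ _ _).1 (not_le.1 hc)
  exact lt_irrefl _ ((π.lt_colHeight_iff _ j k).2 (by omega))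

theorem levels_last : π.levels a (Fin.last c) = 0 := by
  funext j
  rw [Fin.ext_iff]
  by_contra hc
  have h1 := (π.lt_colHeight_iff 0 j c).1 (Nat.pos_of_ne_zero hc)
  have := π.entry_le 0 j
  omega

/-- A descent of entry `k + 1` in column `j` is the lowest occurrence of `k + 1` there. It exists,
uniquely, if and only if the column heights at levels `k` and `k + 1` differ. -/
theorem gWeight_eq_prod_levels (q : Fin c → ℝ) (ha : π.lambda1 ≤ a) :
    gWeight b q π = ∏ k : Fin c, ∏ j : Fin a,
      jumpKernel (q k) (π.levels a k.castSucc j) (π.levels a k.succ j) := by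
  rw [← Fintype.prod_prod_type' (f := fun (k : Fin c) (j : Fin a) =>
    jumpKernel (q k) (π.levels a k.castSucc j) (π.levels a k.succ j))]
  simp only [jumpKernel]
  rw [← Finset.prod_filter, gWeight]
  rw [π.lambda1_le_iff] at ha
  have hdes (p : π.des) : π.entry (p.1.1 + 1) p.1.2 < π.entry p.1.1 p.1.2 :=
    (π.mem_des p.1).1 p.2
  refine Finset.prod_bij (fun p _ => (π.level p, (⟨p.1.2, ?_⟩ : Fin a))) ?_ ?_ ?_ ?_
  · by_contra h
    have := hdes p
    rw [ha p.1.1 p.1.2 (not_lt.1 h)] at this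
    omega
  · rintro p -
    have h := hdes p
    refine Finset.mem_filter.2 ⟨Finset.mem_univ _, ?_⟩
    change π.colHeight (π.entry p.1.1 p.1.2 - 1 + 1) p.1.2 <
      π.colHeight (π.entry p.1.1 p.1.2 - 1) p.1.2
    have h1 := (π.lt_colHeight_iff p.1.1 p.1.2 (π.entry p.1.1 p.1.2 - 1)).2 (by omega)
    have h2 := (π.lt_colHeight_iff p.1.1 p.1.2 (π.entry p.1.1 p.1.2 - 1 + 1)).not.2 (by omega)
    omega
  · rintro p - p' - hpp
    simp only [Prod.mk.injEq, level, Fin.mk.injEq] at hpp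
    obtain ⟨h1, h2⟩ := hpp
    have e1 := hdes p
    have e2 := hdes p'
    rw [h2] at h1 e1
    refine Subtype.ext (Prod.ext ?_ h2)
    rcases lt_trichotomy p.1.1 p'.1.1 with h | h | h
    · have : π.entry p'.1.1 p'.1.2 ≤ π.entry (p.1.1 + 1) p'.1.2 := π.antitone_col _ h
      omega
    · exact h
    · have : π.entry p.1.1 p'.1.2 ≤ π.entry (p'.1.1 + 1) p'.1.2 := π.antitone_col _ h
      omega
  · rintro ⟨k, j⟩ hkj
    replace hkj : π.colHeight (k + 1) j < π.colHeight k j := (Finset.mem_filter.1 hkj).2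
    obtain ⟨i, hi⟩ : ∃ i, π.colHeight k j = i + 1 := ⟨π.colHeight k j - 1, by omega⟩
    have h1 := (π.lt_colHeight_iff i j k).1 (by omega)
    have h2 := (π.lt_colHeight_iff (i + 1) j k).not.1 (by omega)
    have h3 := (π.lt_colHeight_iff i j (k + 1)).not.1 (by omega)
    refine ⟨⟨(i, j), (π.mem_des _).2 (by simp only; omega)⟩, Finset.mem_univ _, ?_⟩
    simp only [level, Prod.mk.injEq, Fin.ext_iff, and_true]
    omega
  · intro p _
    rfl

theorem stepWeight_levels (q : Fin c → ℝ) (ha : π.lambda1 ≤ a) :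
    ∏ k : Fin c, stepWeight (jumpKernel (q k)) (π.levels a k.castSucc) (π.levels a k.succ) =
      gWeight b q π := by
  rw [π.gWeight_eq_prod_levels q ha]
  refine Finset.prod_congr rfl fun k _ => ?_
  rw [stepWeight, if_pos]
  exact ⟨π.levels_antitone _, fun j => π.colHeight_succ_le k j⟩

theorem levels_injective :
    Function.Injective fun π : {π : PP b c // π.lambda1 ≤ a} => π.1.levels a := by
  intro π π' h
  refine Subtype.ext (entry_injective fun i j => ?_)
  by_cases hj : a ≤ j
  · rw [π.1.lambda1_le_iff.1 π.2 i j hj, π'.1.lambda1_le_iff.1 π'.2 i j hj]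
  · have key : ∀ k, k ≤ c → (k < π.1.entry i j ↔ k < π'.1.entry i j) := by
      intro k hk
      have h1 := congrArg Fin.val (congrFun (congrFun h ⟨k, by omega⟩) ⟨j, not_le.1 hj⟩)
      simp only [levels] at h1
      rw [← lt_colHeight_iff, ← lt_colHeight_iff, h1]
    have h1 := π.1.entry_le i j
    have h2 := π'.1.entry_le i j
    have h3 := key _ h1
    have h4 := key _ h2
    omega

end PP

/-- Conjugation in the level variable inverts `levels`: the entry at `(i, j)` is the number of `k`
with `M k j > i`. -/
theorem exists_levels_eq {a b c : ℕ} (M : Fin (c + 1) → Fin a → Fin (b + 1))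
    (hlast : M (Fin.last c) = 0) (hM : ∀ k, Antitone (M k))
    (hle : ∀ (k : Fin c) j, M k.succ j ≤ M k.castSucc j) :
    ∃ π : PP b c, π.lambda1 ≤ a ∧ π.levels a = M := by
  let m : ℕ → ℕ → ℕ := fun k j =>
    if h : k < c + 1 ∧ j < a then (M ⟨k, h.1⟩ ⟨j, h.2⟩ : ℕ) else 0
  have hmk : ∀ k j, m (k + 1) j ≤ m k j := by
    intro k j
    simp only [m]
    by_cases h : k + 1 < c + 1 ∧ j < a
    · rw [dif_pos h, dif_pos ⟨by omega, h.2⟩]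
      exact hle ⟨k, by omega⟩ ⟨j, h.2⟩
    · rw [dif_neg h]
      exact Nat.zero_le _
  have hmj : ∀ k j, m k (j + 1) ≤ m k j := by
    intro k j
    simp only [m]
    by_cases h : k < c + 1 ∧ j + 1 < a
    · rw [dif_pos h, dif_pos ⟨h.1, by omega⟩]
      exact hM _ (Fin.le_def.2 (Nat.le_succ j))
    · rw [dif_neg h]
      exact Nat.zero_le _
  have hmb : ∀ k j, m k j ≤ b := by
    intro k j
    simp only [m]
    split_ifs
    · exact Fin.is_le _
    · exact Nat.zero_le _
  have hma : ∀ k j, a ≤ j → m k j = 0 := fun k j h => dif_neg (by omega)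
  have hmc : ∀ j, m c j = 0 := by
    intro j
    simp only [m]
    split_ifs with h
    · exact congrArg Fin.val (congrFun hlast ⟨j, h.2⟩)
    · rfl
  have hlt : ∀ i j k, k < conjSeq (fun k => m k j) i ↔ i < m k j := fun i j k =>
    lt_conjSeq_iff (antitone_nat_of_succ_le fun k => hmk k j) ⟨c, by simp [hmc]⟩ k
  have hzero : ∀ i j, a ≤ j → conjSeq (fun k => m k j) i = 0 := by
    intro i j hj
    have := (hlt i j 0).not.2 (by rw [hma _ _ hj]; omega)
    omega
  let π : PP b c := PP.ofEntry (fun i j => conjSeq (fun k => m k j) i)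
    (fun i j => by
      by_contra hc
      have h1 := (hlt _ _ _).1 (not_le.1 hc)
      exact lt_irrefl _ ((hlt i j _).2 (by omega)))
    (fun i j => by
      by_contra hc
      have h1 := (hlt _ _ _).1 (not_le.1 hc)
      exact lt_irrefl _ ((hlt i j _).2 (h1.trans_le (hmj _ _))))
    (fun j => by
      have h1 := (hlt b j 0).not.2 (by have := hmb 0 j; omega)
      omega)
    ⟨a, hzero 0 a le_rfl⟩
    (fun i j => by
      have h1 := (hlt i j c).not.2 (by rw [hmc]; omega)
      omega)
  have hπ : ∀ i j, π.entry i j = conjSeq (fun k => m k j) i := fun i j => rfl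
  refine ⟨π, π.lambda1_le_iff.2 fun i j hj => hzero i j hj, ?_⟩
  funext k j
  rw [Fin.ext_iff]
  have hmkj : m k j = M k j := dif_pos ⟨k.2, j.2⟩
  have : ∀ i, i < π.colHeight k j ↔ i < m k j := by
    intro i
    rw [π.lt_colHeight_iff, hπ, hlt]
  have h1 := this (π.colHeight k j)
  have h2 := this (m k j)
  simp only [PP.levels]
  omega

/-- Sums over plane partitions with at most `a` columns, as sums over chains. -/
theorem hasSum_gWeight_levels {a b c : ℕ} (q : Fin c → ℝ)
    (φ : (Fin (c + 1) → Fin a → Fin (b + 1)) → ℝ) :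
    HasSum (fun π : {π : PP b c // π.lambda1 ≤ a} => gWeight b q π.1 * φ (π.1.levels a))
      (∑ M : Fin (c + 1) → Fin a → Fin (b + 1), open Classical in (if M (Fin.last c) = 0 then
        (if Antitone (M 0) then 1 else 0) *
          ∏ k, stepWeight (jumpKernel (q k)) (M k.castSucc) (M k.succ) else 0) * φ M) := by
  classical
  have hinj := PP.levels_injective (a := a) (b := b) (c := c)
  have := (hinj.hasSum_iff (f := fun M : Fin (c + 1) → Fin a → Fin (b + 1) =>
    (if M (Fin.last c) = 0 then (if Antitone (M 0) then 1 else 0) *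
      ∏ k, stepWeight (jumpKernel (q k)) (M k.castSucc) (M k.succ) else 0) * φ M) ?_).2
      (hasSum_fintype _)
  · convert this using 2 with π
    simp only [Function.comp_apply, π.1.levels_last, if_true, π.1.levels_antitone, one_mul,
      π.1.stepWeight_levels q π.2]
  -- Outside the image of `levels` the summand vanishes: a nonzero weight forces every condition
  -- needed to rebuild a plane partition.
  · intro M hM
    by_contra hc
    have h1 := left_ne_zero_of_mul hc
    have hlast : M (Fin.last c) = 0 := by
      by_contra h
      exact h1 (if_neg h)
    rw [if_pos hlast] at h1
    have h0 : Antitone (M 0) := by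
      by_contra h
      exact left_ne_zero_of_mul h1 (if_neg h)
    have hw := fun k => stepWeight_ne_zero
      (Finset.prod_ne_zero_iff.1 (right_ne_zero_of_mul h1) k (Finset.mem_univ k))
    obtain ⟨π, hπ, h⟩ := exists_levels_eq M hlast
      (fun k => Fin.cases h0 (fun k => (hw k).1) k) (fun k => (hw k).2)
    exact hM ⟨⟨π, hπ⟩, h⟩

/-! ### Determinantal formulas for the two chain sums -/

open PowerSeries in
/-- The generating function of `π ∈ PP(∞, b, c)` with at most `a` columns is a determinant. -/
theorem hasSum_gWeight_lambda1_le {b c : ℕ} (a : ℕ) (q : Fin c → ℝ) :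
    HasSum (fun π : {π : PP b c // π.lambda1 ≤ a} => gWeight b q π.1)
      (Matrix.det fun i : Fin a =>
        jacobiTrudiRow a ((∏ k, (1 + C (q k) * X)) * (1 + X) ^ b) i b) := by
  classical
  have hinv : ((1 + X : PowerSeries ℝ)⁻¹) * (1 + X) = 1 := PowerSeries.inv_mul_cancel _ (by simp)
  have h := hasSum_gWeight_levels (a := a) (b := b) q fun _ => 1
  simp only [mul_one] at h
  convert h using 1
  rw [sum_chain_det q jumpKernel (grothendieckRow a)
    (fun P y l hl => sum_stepWeight_mul_det_grothendieckRow P y l hl) _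
    (fun l hl => det_grothendieckRow_inv l hl hinv) (fun l => if Antitone l then 1 else 0)
    (fun l hl => by by_contra h; exact hl (if_neg h))]
  -- The free sum over the initial sequence is a jump step with `x = 1` from the constant sequence
  -- `b`; its factor `1 + X` cancels the inverse.
  have hlast := sum_stepWeight_mul_det_grothendieckRow (a := a)
    ((1 + X : PowerSeries ℝ)⁻¹ * ∏ k, (1 + C (q k) * X)) 1 (fun _ => Fin.last b) antitone_const
  have hu : ∀ l : Fin a → Fin (b + 1), stepWeight (jumpKernel 1) (fun _ => Fin.last b) l =
      if Antitone l then 1 else 0 := by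
    intro l
    simp [stepWeight, jumpKernel, Fin.le_last]
  simp only [hu] at hlast
  rw [hlast]
  have hP : (1 + X : PowerSeries ℝ)⁻¹ * (∏ k, (1 + C (q k) * X)) * (1 + C 1 * X) =
      ∏ k, (1 + C (q k) * X) := by
    rw [map_one, one_mul, mul_right_comm, hinv, one_mul]
  rw [hP]
  rfl

theorem stepWeight_stripKernel {a b : ℕ} (x : ℝ) (l m : Fin a → Fin (b + 1)) :
    stepWeight (stripKernel x) l m =
      stepWeight (jumpKernel x) l m * if ∀ j, (l j : ℕ) ≤ m j + 1 then 1 else 0 := by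
  classical
  unfold stepWeight
  by_cases h : Antitone m ∧ ∀ i, m i ≤ l i
  · rw [if_pos h, if_pos h]
    split_ifs with h1
    · rw [mul_one]
      refine Finset.prod_congr rfl fun j _ => ?_
      simp [stripKernel, jumpKernel, h1 j]
    · rw [mul_zero]
      obtain ⟨j, hj⟩ := not_forall.1 h1
      refine Finset.prod_eq_zero (Finset.mem_univ j) ?_
      have : (m j : ℕ) < l j := by omega
      simp [stripKernel, hj, Fin.lt_def.2 this]
  · rw [if_neg h, if_neg h, zero_mul]

/-- A chain from the full rectangle whose steps remove at most one cell from each column. -/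
def IsStripChain {a b n : ℕ} (M : Fin (n + 1) → Fin a → Fin (b + 1)) : Prop :=
  M 0 = (fun _ => Fin.last b) ∧ ∀ (k : Fin n) j, (M k.castSucc j : ℕ) ≤ M k.succ j + 1

open PowerSeries in
theorem hasSum_gWeight_isStripChain {b n : ℕ} (a : ℕ) (x : Fin n → ℝ) :
    HasSum (fun π : {π : PP b n // π.lambda1 ≤ a} => open Classical in
        gWeight b x π.1 * if IsStripChain (π.1.levels a) then 1 else 0)
      (Matrix.det fun i : Fin a => jacobiTrudiRow a (∏ k, (1 + C (x k) * X)) i b) := by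
  classical
  convert hasSum_gWeight_levels (a := a) (b := b) x
    (fun M => if IsStripChain M then 1 else 0) using 1
  have h := sum_chain_det (a := a) (b := b) x stripKernel (jacobiTrudiRow a)
    (fun P y l hl => sum_stepWeight_mul_det_jacobiTrudiRow P y l hl) 1
    (fun l hl => det_jacobiTrudiRow_one l hl) (fun l => if l = fun _ => Fin.last b then 1 else 0)
    (fun l hl => by
      have : l = fun _ => Fin.last b := by by_contra h; exact hl (if_neg h)
      rw [this]
      exact antitone_const)
  rw [one_mul] at h
  have hsum : ∑ l : Fin a → Fin (b + 1), (if l = fun _ => Fin.last b then (1 : ℝ) else 0) *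
      Matrix.det (fun i => jacobiTrudiRow a (∏ k, (1 + C (x k) * X)) i (l i)) =
      Matrix.det fun i : Fin a => jacobiTrudiRow a (∏ k, (1 + C (x k) * X)) i b := by
    simp
  rw [← hsum, ← h]
  refine Finset.sum_congr rfl fun M _ => ?_
  by_cases hl : M (Fin.last n) = 0
  swap
  · simp [hl]
  rw [if_pos hl, if_pos hl]
  simp only [stepWeight_stripKernel]
  rw [Finset.prod_mul_distrib]
  by_cases h0 : M 0 = fun _ => Fin.last b
  swap
  · simp [h0, IsStripChain]
  have h0' : Antitone (M 0) := by rw [h0]; exact antitone_const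
  rw [if_pos h0, if_pos h0', one_mul, one_mul]
  congr 1
  by_cases hs : ∀ (k : Fin n) j, (M k.castSucc j : ℕ) ≤ M k.succ j + 1
  · simp [hs, IsStripChain, h0]
  · rw [if_neg fun h => hs h.2]
    obtain ⟨k, hk⟩ := not_forall.1 hs
    exact Finset.prod_eq_zero (Finset.mem_univ k) (if_neg hk)

/-! ### Semistandard tableaux of rectangular shape as plane partitions -/

section Tableaux

variable {a b n : ℕ}

theorem mem_rectDiagram {i j : ℕ} : (i, j) ∈ rectDiagram a b ↔ i < b ∧ j < a := by
  rw [← YoungDiagram.mem_cells]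
  simp [rectDiagram]

namespace BoundedSSYT

variable (T : BoundedSSYT (rectDiagram a b) n)

theorem lt_of_lt {i j : ℕ} (hi : i < b) (hj : j < a) : T.1 i j < n :=
  T.2 (i, j) ((YoungDiagram.mem_cells _).2 (mem_rectDiagram.2 ⟨hi, hj⟩))

/-- The column-strict plane partition obtained by complementing the entries of a tableau. -/
noncomputable def toPP : PP b n :=
  PP.ofEntry (fun i j => if i < b ∧ j < a then n - T.1 i j else 0)
    (fun i j => by
      by_cases h : i + 1 < b ∧ j < a
      · have := T.1.col_strict (Nat.lt_add_one i) (mem_rectDiagram.2 h)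
        rw [if_pos h, if_pos ⟨by omega, h.2⟩]
        omega
      · rw [if_neg h]
        exact Nat.zero_le _)
    (fun i j => by
      by_cases h : i < b ∧ j + 1 < a
      · have := T.1.row_weak (Nat.lt_add_one j) (mem_rectDiagram.2 h)
        rw [if_pos h, if_pos ⟨h.1, by omega⟩]
        omega
      · rw [if_neg h]
        exact Nat.zero_le _)
    (fun j => by simp) ⟨a, by simp⟩
    (fun i j => by split_ifs <;> omega)

theorem toPP_entry (i j : ℕ) :
    T.toPP.entry i j = if i < b ∧ j < a then n - T.1 i j else 0 := rfl

theorem toPP_lambda1_le : T.toPP.lambda1 ≤ a :=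
  T.toPP.lambda1_le_iff.2 fun i j hj => by
    rw [toPP_entry, if_neg (by omega)]

theorem toPP_succ_lt {i j : ℕ} (hi : i < b) (hj : j < a) :
    T.toPP.entry (i + 1) j < T.toPP.entry i j := by
  have h1 := T.lt_of_lt hi hj
  rw [toPP_entry, toPP_entry, if_pos (c := i < b ∧ j < a) ⟨hi, hj⟩]
  split_ifs with h
  · have := T.1.col_strict (Nat.lt_add_one i) (mem_rectDiagram.2 h)
    omega
  · omega

theorem toPP_injective :
    Function.Injective fun T : BoundedSSYT (rectDiagram a b) n =>
      (⟨T.toPP, T.toPP_lambda1_le⟩ : {π : PP b n // π.lambda1 ≤ a}) := by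
  intro T T' h
  apply Subtype.ext
  apply SemistandardYoungTableau.ext
  intro i j
  by_cases hij : i < b ∧ j < a
  · have h1 : T.toPP.entry i j = T'.toPP.entry i j := by rw [(Subtype.mk.inj h)]
    rw [toPP_entry, toPP_entry, if_pos hij, if_pos hij] at h1
    have h2 := T.lt_of_lt hij.1 hij.2
    have h3 := T'.lt_of_lt hij.1 hij.2
    omega
  · have hij' : (i, j) ∉ rectDiagram a b := fun h => hij (mem_rectDiagram.1 h)
    rw [T.1.zeros hij', T'.1.zeros hij']

/-- Positive entries fill the rectangle at level `0`; strict columns contain each value at most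
once, so a column height drops by at most one per level. -/
theorem isStripChain_levels_toPP : IsStripChain (T.toPP.levels a) := by
  constructor
  · funext j
    rw [Fin.ext_iff]
    change T.toPP.colHeight 0 j = b
    have h1 := T.toPP.colHeight_le 0 j
    by_contra hc
    have hlt : T.toPP.colHeight 0 j < b := by omega
    have h2 := T.toPP_succ_lt hlt j.2
    exact lt_irrefl _ ((T.toPP.lt_colHeight_iff _ j 0).2 (by omega))
  · intro k j
    change T.toPP.colHeight k j ≤ T.toPP.colHeight (k + 1) j + 1
    by_contra hc
    set h := T.toPP.colHeight (k + 1) j with hh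
    have h1 := (T.toPP.lt_colHeight_iff (h + 1) j k).1 (not_le.1 hc)
    have h2 := T.toPP.colHeight_le k j
    have h3 := T.toPP_succ_lt (i := h) (by omega) j.2
    have h4 := (T.toPP.lt_colHeight_iff h j (k + 1)).2 (by omega)
    omega

/-- Every cell of the rectangle is a descent, and the entry `n - T` has `0`-based level `n - 1 - T`,
whence `Fin.rev`. -/
theorem gWeight_toPP (x : Fin n → ℝ) :
    gWeight b (x ∘ Fin.rev) T.toPP =
      ∏ p : (rectDiagram a b).cells, x ⟨T.1 p.1.1 p.1.2, T.2 p.1 p.2⟩ := by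
  have hmem : ∀ p : ℕ × ℕ, p ∈ T.toPP.des ↔ p ∈ (rectDiagram a b).cells := by
    rintro ⟨i, j⟩
    rw [PlanePartition.mem_des, YoungDiagram.mem_cells, mem_rectDiagram]
    constructor
    · intro h
      by_contra hc
      simp only [toPP_entry, if_neg hc] at h
      omega
    · exact fun h => T.toPP_succ_lt h.1 h.2
  refine Fintype.prod_equiv (Equiv.subtypeEquivRight hmem) _ _ ?_
  rintro ⟨⟨i, j⟩, hp⟩
  simp only [Function.comp_apply, Equiv.subtypeEquivRight_apply_coe]
  congr 1
  have hij := mem_rectDiagram.1 ((YoungDiagram.mem_cells _).1 ((hmem _).1 hp))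
  have h1 := T.lt_of_lt hij.1 hij.2
  have h2 := T.toPP_entry i j
  rw [if_pos hij] at h2
  simp only [Fin.ext_iff, Fin.val_rev, PP.level]
  omega

end BoundedSSYT

theorem exists_toPP_eq (π : PP b n) (ha : π.lambda1 ≤ a) (h : IsStripChain (π.levels a)) :
    ∃ T : BoundedSSYT (rectDiagram a b) n, T.toPP = π := by
  have hpos : ∀ i j, i < b → j < a → 0 < π.entry i j := by
    intro i j hi hj
    have h1 : π.colHeight 0 j = b := congrArg Fin.val (congrFun h.1 ⟨j, hj⟩)
    exact (π.lt_colHeight_iff i j 0).1 (by omega)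
  have hstrict : ∀ i j, i + 1 < b → j < a → π.entry (i + 1) j < π.entry i j := by
    intro i j hi hj
    obtain ⟨k, hk⟩ : ∃ k, π.entry (i + 1) j = k + 1 :=
      ⟨π.entry (i + 1) j - 1, by have := hpos _ _ hi hj; omega⟩
    have hkn := π.entry_le (i + 1) j
    have h1 : π.colHeight k j ≤ π.colHeight (k + 1) j + 1 := h.2 ⟨k, by omega⟩ ⟨j, hj⟩
    have h2 := (π.lt_colHeight_iff (i + 1) j k).2 (by omega)
    have h3 := (π.lt_colHeight_iff i j (k + 1)).1 (by omega)
    omega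
  refine ⟨⟨⟨fun i j => if i < b ∧ j < a then n - π.entry i j else 0, ?_, ?_, ?_⟩, ?_⟩, ?_⟩
  · intro i j₁ j₂ hj hm
    have hm := mem_rectDiagram.1 hm
    rw [if_pos hm, if_pos ⟨hm.1, by omega⟩]
    have : π.entry i j₂ ≤ π.entry i j₁ := π.antitone_row i hj.le
    omega
  · intro i₁ i₂ j hi hm
    have hm := mem_rectDiagram.1 hm
    rw [if_pos hm, if_pos ⟨by omega, hm.2⟩]
    have h1 : π.entry i₂ j ≤ π.entry (i₁ + 1) j := π.antitone_col j hi
    have h2 := hstrict i₁ j (by omega) hm.2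
    have h3 := π.entry_le i₁ j
    omega
  · intro i j hm
    exact if_neg fun h => hm (mem_rectDiagram.2 h)
  · rintro ⟨i, j⟩ hm
    have hm := mem_rectDiagram.1 ((YoungDiagram.mem_cells _).1 hm)
    change (if i < b ∧ j < a then n - π.entry i j else 0) < n
    rw [if_pos hm]
    have := hpos i j hm.1 hm.2
    have := π.entry_le i j
    omega
  · refine PP.entry_injective fun i j => ?_
    rw [BoundedSSYT.toPP_entry]
    change (if i < b ∧ j < a then n - (if i < b ∧ j < a then n - π.entry i j else 0) else 0) = _
    split_ifs with hij
    · have := π.entry_le i j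
      omega
    · symm
      by_cases hi : i < b
      · exact π.lambda1_le_iff.1 ha i j (by omega)
      · exact π.entry_eq_zero_of_le (by omega) j

open PowerSeries in
/-- The dual Jacobi–Trudi formula for a rectangular Schur polynomial. -/
theorem eval_schurPoly_rectDiagram (x : Fin n → ℝ) :
    MvPolynomial.eval x (schurPoly (rectDiagram a b) n) =
      Matrix.det fun i : Fin a => jacobiTrudiRow a (∏ k, (1 + C (x k) * X)) i b := by
  classical
  have h := hasSum_gWeight_isStripChain (b := b) a (x ∘ Fin.rev)
  -- The determinant is symmetric in the variables, so the reversal caused by complementation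
  -- disappears.
  have hprod : ∏ k, (1 + C ((x ∘ Fin.rev) k) * X) = ∏ k, (1 + C (x k) * X) :=
    Equiv.prod_comp Fin.revPerm fun k => 1 + C (x k) * X
  rw [hprod, ← BoundedSSYT.toPP_injective.hasSum_iff] at h
  · refine Eq.trans ?_ (h.unique (hasSum_fintype _)).symm
    simp only [schurPoly, map_sum, map_prod, MvPolynomial.eval_X]
    refine Finset.sum_congr rfl fun T _ => ?_
    simp only [Function.comp_apply, if_pos T.isStripChain_levels_toPP, mul_one]
    exact (T.gWeight_toPP x).symm
  · intro π hπ
    rw [if_neg, mul_zero]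
    intro hs
    obtain ⟨T, hT⟩ := exists_toPP_eq π.1 π.2 hs
    exact hπ ⟨T, Subtype.ext hT⟩

end Tableaux

/-! ### Plane partitions and nonnegative integer matrices -/

namespace PP

variable {b c : ℕ} (π : PP b c)

/-- The number of entries exceeding `k` in row `i`. -/
noncomputable def rowCount (i k : ℕ) : ℕ := conjSeq (π.entry i) k

theorem lt_rowCount_iff (i j k : ℕ) : j < π.rowCount i k ↔ k < π.entry i j :=
  lt_conjSeq_iff (π.antitone_row i)
    ⟨π.lambda1, by simp [π.lambda1_le_iff.1 le_rfl i π.lambda1 le_rfl]⟩ j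

theorem rowCount_eq_zero {i k : ℕ} (h : b ≤ i ∨ c ≤ k) : π.rowCount i k = 0 := by
  by_contra hc
  have h1 := (π.lt_rowCount_iff i 0 k).1 (Nat.pos_of_ne_zero hc)
  have h2 := π.entry_le i 0
  rcases h with h | h
  · have := π.entry_eq_zero_of_le h 0
    omega
  · omega

theorem rowCount_succ_right_le (i k : ℕ) : π.rowCount i (k + 1) ≤ π.rowCount i k := by
  by_contra hc
  have h2 := (π.lt_rowCount_iff _ _ _).1 (not_le.1 hc)
  exact lt_irrefl _ ((π.lt_rowCount_iff i _ k).2 (by omega))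

theorem rowCount_succ_left_le (i k : ℕ) : π.rowCount (i + 1) k ≤ π.rowCount i k := by
  by_contra hc
  have h2 := (π.lt_rowCount_iff _ _ _).1 (not_le.1 hc)
  exact lt_irrefl _ ((π.lt_rowCount_iff i _ k).2 (h2.trans_le (π.col_le _ _)))

/-- The number of descents in row `i` with entry `k + 1`. -/
noncomputable def descentCount (i : Fin b) (k : Fin c) : ℕ :=
  π.rowCount i k - max (π.rowCount i (k + 1)) (π.rowCount (i + 1) k)

/-- The last passage recursion. -/
theorem rowCount_eq (i : Fin b) (k : Fin c) :
    π.rowCount i k =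
      π.descentCount i k + max (π.rowCount i (k + 1)) (π.rowCount (i + 1) k) := by
  have h1 := π.rowCount_succ_right_le i k
  have h2 := π.rowCount_succ_left_le i k
  rw [descentCount]
  omega

/-- In row `i`, the entry at `j` is `k + 1` with at most `k` below it exactly when `j` lies below
`rowCount i k` but not below `rowCount i (k + 1)` or `rowCount (i + 1) k`. -/
theorem gWeight_eq_prod_descentCount (q : Fin c → ℝ) :
    gWeight b q π = ∏ i : Fin b, ∏ k : Fin c, q k ^ π.descentCount i k := by
  rw [← Fintype.prod_prod_type' (f := fun (i : Fin b) (k : Fin c) => q k ^ π.descentCount i k)]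
  have hdes (p : π.des) : π.entry (p.1.1 + 1) p.1.2 < π.entry p.1.1 p.1.2 :=
    (π.mem_des p.1).1 p.2
  have hrow (p : π.des) : p.1.1 < b := by
    by_contra h
    have h1 := π.entry_eq_zero_of_le (not_lt.1 h) p.1.2
    have h2 := hdes p
    omega
  rw [gWeight, ← Finset.prod_fiberwise' Finset.univ
    (fun p : π.des => ((⟨p.1.1, hrow p⟩ : Fin b), π.level p)) (fun x => q x.2)]
  refine Finset.prod_congr rfl fun x _ => ?_
  obtain ⟨i, k⟩ := x
  rw [Finset.prod_const]
  change _ = q k ^ π.descentCount i k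
  congr 1
  rw [descentCount, ← Nat.card_Ico]
  refine Finset.card_bij (fun p _ => p.1.2) ?_ ?_ ?_
  · intro p hp
    have hp := (Finset.mem_filter.1 hp).2
    simp only [Prod.mk.injEq, Fin.ext_iff, level] at hp
    have h := hdes p
    obtain ⟨h1, h2⟩ := hp
    rw [h1] at h h2
    rw [Finset.mem_Ico, max_le_iff]
    have e1 := π.lt_rowCount_iff i p.1.2 (k + 1)
    have e2 := π.lt_rowCount_iff (i + 1) p.1.2 k
    have e3 := π.lt_rowCount_iff i p.1.2 k
    omega
  · intro p hp p' hp' h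
    have hp := (Finset.mem_filter.1 hp).2
    have hp' := (Finset.mem_filter.1 hp').2
    simp only [Prod.mk.injEq, Fin.ext_iff] at hp hp'
    exact Subtype.ext (Prod.ext (hp.1.trans hp'.1.symm) h)
  · intro j hj
    rw [Finset.mem_Ico, max_le_iff] at hj
    have e1 := π.lt_rowCount_iff i j (k + 1)
    have e2 := π.lt_rowCount_iff (i + 1) j k
    have e3 := π.lt_rowCount_iff i j k
    refine ⟨⟨((i : ℕ), j), (π.mem_des _).2 (by simp only; omega)⟩, ?_, rfl⟩
    refine Finset.mem_filter.2 ⟨Finset.mem_univ _, ?_⟩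
    simp only [Prod.mk.injEq, Fin.ext_iff, level, true_and]
    omega

theorem descentCount_injective :
    Function.Injective (descentCount : PP b c → Fin b → Fin c → ℕ) := by
  intro π π' h
  -- The recursion determines all row counts from the zero boundary `i = b`, `k = c`, by induction
  -- on the distance to that corner.
  have key : ∀ s i k, b - i + (c - k) ≤ s → π.rowCount i k = π'.rowCount i k := by
    intro s
    induction s with
    | zero =>
      intro i k hs
      rw [π.rowCount_eq_zero (by omega), π'.rowCount_eq_zero (by omega)]
    | succ s ih =>
      intro i k hs
      by_cases hik : b ≤ i ∨ c ≤ k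
      · rw [π.rowCount_eq_zero hik, π'.rowCount_eq_zero hik]
      · have h1 := π.rowCount_eq ⟨i, by omega⟩ ⟨k, by omega⟩
        have h2 := π'.rowCount_eq ⟨i, by omega⟩ ⟨k, by omega⟩
        simp only at h1 h2
        rw [h1, h2, h, ih i (k + 1) (by omega), ih (i + 1) k (by omega)]
  refine entry_injective fun i j => ?_
  have hk : ∀ k, k < π.entry i j ↔ k < π'.entry i j := fun k => by
    rw [← lt_rowCount_iff, ← lt_rowCount_iff, key _ i k le_rfl]
  have h1 := hk (π.entry i j)
  have h2 := hk (π'.entry i j)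
  omega

end PP

/-- Last passage times of a weight array. -/
def lastPassage (d : ℕ → ℕ → ℕ) : ℕ → ℕ → ℕ
  | 0, _ => 0
  | _ + 1, 0 => 0
  | i + 1, k + 1 => d i k + max (lastPassage d i (k + 1)) (lastPassage d (i + 1) k)

theorem lastPassage_le_succ_left (d : ℕ → ℕ → ℕ) (i k : ℕ) :
    lastPassage d i k ≤ lastPassage d (i + 1) k := by
  cases k with
  | zero => cases i <;> simp [lastPassage]
  | succ k =>
    rw [lastPassage]
    omega

theorem lastPassage_le_succ_right (d : ℕ → ℕ → ℕ) (i k : ℕ) :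
    lastPassage d i k ≤ lastPassage d i (k + 1) := by
  cases i with
  | zero => simp [lastPassage]
  | succ i =>
    rw [lastPassage.eq_3]
    omega

theorem PP.descentCount_surjective {b c : ℕ} :
    Function.Surjective (PP.descentCount : PP b c → Fin b → Fin c → ℕ) := by
  intro d
  -- Row counts vanish at `i = b` and `k = c`, whereas `lastPassage` starts at `0`, so both
  -- coordinates are reversed.
  let d' : ℕ → ℕ → ℕ := fun s t =>
    if h : s < b ∧ t < c then d ⟨b - 1 - s, by omega⟩ ⟨c - 1 - t, by omega⟩ else 0
  let N : ℕ → ℕ → ℕ := fun i k => lastPassage d' (b - i) (c - k)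
  have hNi : ∀ i k, N (i + 1) k ≤ N i k := by
    intro i k
    by_cases h : i < b
    · simp only [N]
      rw [show b - i = (b - (i + 1)) + 1 by omega]
      exact lastPassage_le_succ_left _ _ _
    · simp only [N]
      rw [show b - i = 0 by omega, show b - (i + 1) = 0 by omega]
  have hNk : ∀ i k, N i (k + 1) ≤ N i k := by
    intro i k
    by_cases h : k < c
    · simp only [N]
      rw [show c - k = (c - (k + 1)) + 1 by omega]
      exact lastPassage_le_succ_right _ _ _
    · simp only [N]
      rw [show c - k = 0 by omega, show c - (k + 1) = 0 by omega]
  have hNb : ∀ k, N b k = 0 := fun k => by simp [N, lastPassage]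
  have hNc : ∀ i, N i c = 0 := fun i => by
    simp only [N, Nat.sub_self]
    cases b - i <;> simp [lastPassage]
  have hNrec : ∀ (i : Fin b) (k : Fin c), N i k = d i k + max (N i (k + 1)) (N (i + 1) k) := by
    intro i k
    have hi := i.2
    have hk := k.2
    simp only [N]
    rw [show b - (i : ℕ) = (b - (i + 1)) + 1 by omega,
      show c - (k : ℕ) = (c - (k + 1)) + 1 by omega, lastPassage.eq_3, max_comm]
    congr 1
    simp only [d']
    rw [dif_pos ⟨by omega, by omega⟩]
    congr 1 <;> rw [Fin.ext_iff] <;> simp only <;> omega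
  have hlt : ∀ i j k, k < conjSeq (N i) j ↔ j < N i k := fun i j k =>
    lt_conjSeq_iff (antitone_nat_of_succ_le (hNk i)) ⟨c, by simp [hNc]⟩ k
  let π : PP b c := PP.ofEntry (fun i j => conjSeq (N i) j)
    (fun i j => by
      by_contra hc
      have h1 := (hlt _ _ _).1 (not_le.1 hc)
      exact lt_irrefl _ ((hlt i j _).2 (h1.trans_le (hNi _ _))))
    (fun i j => by
      by_contra hc
      have h1 := (hlt _ _ _).1 (not_le.1 hc)
      exact lt_irrefl _ ((hlt i j _).2 (by omega)))
    (fun j => by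
      have h1 := (hlt b j 0).not.2 (by rw [hNb]; omega)
      omega)
    ⟨N 0 0, by
      have h1 := (hlt 0 (N 0 0) 0).not.2 (lt_irrefl _)
      omega⟩
    (fun i j => by
      have h1 := (hlt i j c).not.2 (by rw [hNc]; omega)
      omega)
  have hπ : ∀ i k, π.rowCount i k = N i k := by
    intro i k
    have : ∀ j, j < π.rowCount i k ↔ j < N i k := by
      intro j
      rw [π.lt_rowCount_iff]
      exact hlt i j k
    have h1 := this (π.rowCount i k)
    have h2 := this (N i k)
    omega
  refine ⟨π, ?_⟩
  funext i k
  have h1 := π.rowCount_eq i k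
  rw [hπ, hπ, hπ, hNrec i k] at h1
  omega

/-! ### The normalization constant -/

theorem hasSum_mul_of_nonneg {ι κ : Type*} {f : ι → ℝ} {g : κ → ℝ} {s t : ℝ}
    (hf : HasSum f s) (hg : HasSum g t) (hf0 : ∀ x, 0 ≤ f x) (hg0 : ∀ y, 0 ≤ g y) :
    HasSum (fun x : ι × κ => f x.1 * g x.2) (s * t) :=
  hf.mul hg (hf.summable.mul_of_nonneg hg.summable hf0 hg0)

theorem hasSum_pi_prod {n : ℕ} {α : Type*} (f : Fin n → α → ℝ) (s : Fin n → ℝ)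
    (hf : ∀ i x, 0 ≤ f i x) (hs : ∀ i, HasSum (f i) (s i)) :
    HasSum (fun d : Fin n → α => ∏ i, f i (d i)) (∏ i, s i) := by
  induction n with
  | zero => simp
  | succ n ih =>
    have h := ih (fun i => f i.succ) (fun i => s i.succ) (fun i => hf i.succ) (fun i => hs i.succ)
    have h0 : ∀ d : Fin n → α, 0 ≤ ∏ i, f i.succ (d i) := fun d =>
      Finset.prod_nonneg fun i _ => hf i.succ (d i)
    have hmul := hasSum_mul_of_nonneg (hs 0) h (hf 0) h0
    rw [← (Fin.consEquiv fun _ => α).hasSum_iff, Fin.prod_univ_succ]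
    convert hmul using 2 with d
    simp [Fin.consEquiv, Fin.prod_univ_succ]

/-- Via the bijection `descentCount`, the sum factors into one geometric series of ratio `q k` for
each of the `b * c` matrix positions. -/
theorem hasSum_gWeight (b : ℕ) {c : ℕ} (q : Fin c → ℝ) (hq : ∀ i, q i ∈ Set.Ioo (0 : ℝ) 1) :
    HasSum (gWeight b q) (∏ i, (1 - q i) ^ (-(b : ℤ))) := by
  have hgeom : ∀ k, HasSum (fun n : ℕ => q k ^ n) (1 - q k)⁻¹ := fun k =>
    hasSum_geometric_of_lt_one (hq k).1.le (hq k).2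
  have hrow : HasSum (fun d : Fin c → ℕ => ∏ k, q k ^ d k) (∏ k, (1 - q k)⁻¹) :=
    hasSum_pi_prod (fun k n => q k ^ n) _ (fun k n => pow_nonneg (hq k).1.le n) hgeom
  have hrow0 : ∀ d : Fin c → ℕ, 0 ≤ ∏ k, q k ^ d k := fun d =>
    Finset.prod_nonneg fun k _ => pow_nonneg (hq k).1.le (d k)
  have hall := hasSum_pi_prod (n := b) (fun _ (d : Fin c → ℕ) => ∏ k, q k ^ d k)
    (fun _ => ∏ k, (1 - q k)⁻¹) (fun _ => hrow0) fun _ => hrow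
  have h : HasSum (fun π : PP b c => ∏ i, ∏ k, q k ^ π.descentCount i k)
      (∏ _i : Fin b, ∏ k, (1 - q k)⁻¹) :=
    (Equiv.hasSum_iff (f := fun d : Fin b → Fin c → ℕ => ∏ i, ∏ k, q k ^ d i k)
      (Equiv.ofBijective PP.descentCount
        ⟨PP.descentCount_injective, PP.descentCount_surjective⟩)).2 hall
  have hprod : ∏ _i : Fin b, ∏ k, (1 - q k)⁻¹ = ∏ k, (1 - q k) ^ (-(b : ℤ)) := by
    rw [Finset.prod_const, Finset.card_univ, Fintype.card_fin, ← Finset.prod_pow]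
    refine Finset.prod_congr rfl fun k _ => ?_
    rw [zpow_neg, zpow_natCast, inv_pow]
  rw [hprod] at h
  rwa [funext fun π : PP b c => π.gWeight_eq_prod_descentCount q]

/-! ### The symbol -/

theorem prod_one_add_algebraMap_mul {A : Type*} [CommRing A] (f : ℝ →+* A) {c : ℕ}
    (q : Fin c → ℝ) (w : A) :
    ∏ i, (1 + f (q i) * w) = ∑ l ∈ Finset.range (c + 1),
      f (MvPolynomial.eval q (MvPolynomial.esymm (Fin c) ℝ l)) * w ^ l := by
  rw [Finset.prod_one_add, Finset.sum_powerset, Finset.card_univ, Fintype.card_fin]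
  refine Finset.sum_congr rfl fun l _ => ?_
  rw [MvPolynomial.esymm, map_sum, map_sum, Finset.sum_mul]
  refine Finset.sum_congr rfl fun t ht => ?_
  rw [Finset.prod_mul_distrib, Finset.prod_const, (Finset.mem_powersetCard.1 ht).2]
  simp

theorem intChoose_natCast (b m : ℕ) : intChoose b m = b.choose m := by
  simp [intChoose]

-- Expanding in elementary symmetric polynomials gives binomials `b.choose (b + j - i - l)`, and the
-- symmetry of `choose` makes them `b.choose (l + i - j)`. The case split keeps truncated
-- subtraction away from indices outside `[0, b]`.
open PowerSeries in
theorem jacobiTrudiRow_eq_phiHat {a : ℕ} (b : ℕ) {c : ℕ} (q : Fin c → ℝ) (i j : Fin a) :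
    jacobiTrudiRow a ((∏ k, (1 + C (q k) * X)) * (1 + X) ^ b) i b j =
      phiHat b q ((i : ℤ) - (j : ℤ)) := by
  rw [jacobiTrudiRow, prod_one_add_algebraMap_mul C q X, phiHat, Finset.sum_mul, Finset.mul_sum,
    map_sum]
  refine Finset.sum_congr rfl fun l _ => ?_
  generalize MvPolynomial.eval q (MvPolynomial.esymm (Fin c) ℝ l) = e
  have h1 : (X ^ (i : ℕ) * (C e * X ^ l * (1 + X) ^ b) : PowerSeries ℝ) =
      C e * (X ^ ((i : ℕ) + l) * (((1 + Polynomial.X) ^ b : Polynomial ℝ) : PowerSeries ℝ)) := by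
    simp only [Polynomial.coe_pow, Polynomial.coe_add, Polynomial.coe_one, Polynomial.coe_X]
    ring
  rw [h1, coeff_C_mul, mul_comm, coeff_X_pow_mul']
  congr 1
  rcases le_total (j : ℕ) (l + i) with h | h
  · obtain ⟨m, hm⟩ := Nat.exists_eq_add_of_le h
    rw [show (l : ℤ) + ((i : ℤ) - j) = (m : ℕ) by omega, intChoose_natCast]
    by_cases hmb : m ≤ b
    · rw [if_pos (by omega), Polynomial.coeff_coe, Polynomial.coeff_one_add_X_pow,
        show b + (j : ℕ) - (i + l) = b - m by omega, Nat.choose_symm hmb]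
    · rw [if_neg (by omega), Nat.choose_eq_zero_of_lt (by omega), Nat.cast_zero]
  · obtain ⟨m, hm⟩ := Nat.exists_eq_add_of_le h
    rw [if_pos (by omega), Polynomial.coeff_coe, Polynomial.coeff_one_add_X_pow,
      show b + (j : ℕ) - (i + l) = b + m by omega,
      show (l : ℤ) + ((i : ℤ) - j) = -(m : ℤ) by omega]
    rcases Nat.eq_zero_or_pos m with rfl | hm0
    · simp [intChoose]
    · rw [Nat.choose_eq_zero_of_lt (by omega), intChoose, if_neg (by omega)]

theorem hasSum_intChoose_mul_zpow (b : ℕ) (z : ℂ) :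
    HasSum (fun m : ℤ => (intChoose b m : ℂ) * z ^ m) ((1 + z) ^ b) := by
  rw [← (Nat.cast_injective (R := ℤ)).hasSum_iff]
  · have h : HasSum (fun m : ℕ => (b.choose m : ℂ) * z ^ m)
        (∑ m ∈ Finset.range (b + 1), (b.choose m : ℂ) * z ^ m) :=
      hasSum_sum_of_ne_finset_zero fun m hm => by
        rw [Nat.choose_eq_zero_of_lt (by simpa using hm)]
        simp
    convert h using 1
    · funext m
      simp [intChoose_natCast]
    · rw [add_comm, add_pow]
      refine Finset.sum_congr rfl fun m _ => ?_
      rw [one_pow]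
      ring
  · intro m hm
    have : ¬ 0 ≤ m := fun h => hm ⟨m.toNat, Int.toNat_of_nonneg h⟩
    simp [intChoose, this]

/-- The term `e_l z⁻ˡ` of the second product shifts the binomial expansion of `(1 + z) ^ b` by `l`.
-/
theorem hasSum_phiHat_mul_zpow (b : ℕ) {c : ℕ} (q : Fin c → ℝ) {z : ℂ} (hz : z ≠ 0) :
    HasSum (fun k : ℤ => (phiHat b q k : ℂ) * z ^ k)
      ((1 + z) ^ b * ∏ i, (1 + (q i : ℂ) * z⁻¹)) := by
  have hprod := prod_one_add_algebraMap_mul Complex.ofRealHom q z⁻¹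
  simp only [Complex.ofRealHom_eq_coe] at hprod
  rw [hprod, Finset.mul_sum]
  have hterm : ∀ l : ℕ, HasSum (fun k : ℤ => (intChoose b (l + k) : ℂ) *
      (MvPolynomial.eval q (MvPolynomial.esymm (Fin c) ℝ l) : ℝ) * z ^ k)
      ((1 + z) ^ b *
        ((MvPolynomial.eval q (MvPolynomial.esymm (Fin c) ℝ l) : ℝ) * z⁻¹ ^ l)) := by
    intro l
    have h := ((Equiv.addLeft (l : ℤ)).hasSum_iff.2 (hasSum_intChoose_mul_zpow b z)).mul_right
      (((MvPolynomial.eval q (MvPolynomial.esymm (Fin c) ℝ l) : ℝ) : ℂ) * z⁻¹ ^ l)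
    refine (iff_of_eq (congrArg (fun f => HasSum f _) (funext fun k => ?_))).2 h
    simp only [Function.comp_apply, Equiv.coe_addLeft]
    rw [zpow_add₀ hz, zpow_natCast, inv_pow]
    field_simp
  refine (iff_of_eq (congrArg (fun f => HasSum f _) (funext fun k => ?_))).2
    (hasSum_sum (s := Finset.range (c + 1)) fun l _ => hterm l)
  simp [phiHat, Finset.sum_mul]

/-! ### The `g`-measure -/

theorem gWeight_nonneg (b : ℕ) {c : ℕ} (q : Fin c → ℝ) (hq : ∀ i, 0 ≤ q i) (π : PP b c) :
    0 ≤ gWeight b q π :=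
  Finset.prod_nonneg fun p _ => hq (π.level p)

theorem gMeasure_apply_of_hasSum (b : ℕ) {c : ℕ} (q : Fin c → ℝ) (hq : ∀ i, 0 ≤ q i)
    (hZ : 0 ≤ gZ b q) (A : Set (PP b c)) {s : ℝ}
    (hs : HasSum (fun π : A => gWeight b q π) s) :
    gMeasure b q A = ENNReal.ofReal (s / gZ b q) := by
  have hnn : ∀ π : A, 0 ≤ gWeight b q π / gZ b q := fun π =>
    div_nonneg (gWeight_nonneg b q hq π) hZ
  have hmeas : MeasurableSet A := MeasurableSpace.measurableSet_top
  have h := hs.div_const (gZ b q)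
  rw [← h.tsum_eq, ENNReal.ofReal_tsum_of_nonneg hnn h.summable, gMeasure,
    Measure.sum_apply _ hmeas,
    tsum_subtype A fun π => ENNReal.ofReal (gWeight b q π / gZ b q)]
  refine tsum_congr fun π => ?_
  rw [Measure.smul_apply, Measure.dirac_apply' _ hmeas, smul_eq_mul]
  by_cases hπ : π ∈ A <;> simp [hπ]

theorem gZ_eq (b : ℕ) {c : ℕ} (q : Fin c → ℝ) (hq : ∀ i, q i ∈ Set.Ioo (0 : ℝ) 1) :
    gZ b q = ∏ i, (1 - q i) ^ (-(b : ℤ)) :=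
  (hasSum_gWeight b q hq).tsum_eq

theorem gZ_pos (b : ℕ) {c : ℕ} (q : Fin c → ℝ) (hq : ∀ i, q i ∈ Set.Ioo (0 : ℝ) 1) :
    0 < gZ b q := by
  rw [gZ_eq b q hq]
  exact Finset.prod_pos fun i _ => zpow_pos (sub_pos.2 (hq i).2) _

theorem isProbabilityMeasure_gMeasure (b : ℕ) {c : ℕ} (q : Fin c → ℝ)
    (hq : ∀ i, q i ∈ Set.Ioo (0 : ℝ) 1) : IsProbabilityMeasure (gMeasure b q) := by
  have hq0 : ∀ i, 0 ≤ q i := fun i => (hq i).1.le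
  have hZ := gZ_pos b q hq
  have hsum : HasSum (gWeight b q) (gZ b q) := (hasSum_gWeight b q hq).summable.hasSum
  have huniv : HasSum (fun π : (Set.univ : Set (PP b c)) => gWeight b q π) (gZ b q) :=
    (Equiv.hasSum_iff (f := gWeight b q) (Equiv.Set.univ (PP b c))).2 hsum
  constructor
  rw [gMeasure_apply_of_hasSum b q hq0 hZ.le Set.univ huniv,
    div_self hZ.ne', ENNReal.ofReal_one]

theorem gMeasure_real_lambda1_le (b : ℕ) {c : ℕ} (q : Fin c → ℝ)
    (hq : ∀ i, q i ∈ Set.Ioo (0 : ℝ) 1) (a : ℕ) :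
    (gMeasure b q).real {π | π.lambda1 ≤ a} =
      (Matrix.of fun i j : Fin a => phiHat b q ((i : ℤ) - (j : ℤ))).det / gZ b q := by
  have hq0 : ∀ i, 0 ≤ q i := fun i => (hq i).1.le
  have h := hasSum_gWeight_lambda1_le (b := b) a q
  have hM : (fun i : Fin a => jacobiTrudiRow a
      ((∏ k, (1 + PowerSeries.C (q k) * PowerSeries.X)) * (1 + PowerSeries.X) ^ b) i b) =
      Matrix.of fun i j : Fin a => phiHat b q ((i : ℤ) - (j : ℤ)) := by
    funext i j
    exact jacobiTrudiRow_eq_phiHat b q i j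
  rw [hM] at h
  have hnn : ∀ π : {π : PP b c // π.lambda1 ≤ a}, 0 ≤ gWeight b q π.1 := fun π =>
    gWeight_nonneg b q hq0 π.1
  rw [measureReal_def, gMeasure_apply_of_hasSum b q hq0 (gZ_pos b q hq).le
    {π | π.lambda1 ≤ a} h, ENNReal.toReal_ofReal]
  exact div_nonneg (HasSum.nonneg hnn h) (gZ_pos b q hq).le

/-- The `b` variables equal to `1` supply the factor `(1 + X) ^ b` in the dual Jacobi–Trudi
generating function. -/
theorem det_phiHat_eq_eval_schurPoly (a b : ℕ) {c : ℕ} (q : Fin c → ℝ) :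
    (Matrix.of fun i j : Fin a => phiHat b q ((i : ℤ) - (j : ℤ))).det =
      MvPolynomial.eval (Fin.append (fun _ : Fin b => (1 : ℝ)) q)
        (schurPoly (rectDiagram a b) (b + c)) := by
  rw [eval_schurPoly_rectDiagram]
  congr 1
  funext i j
  rw [Matrix.of_apply, ← jacobiTrudiRow_eq_phiHat, Fin.prod_univ_add]
  simp [mul_comm]

theorem theorem6p3 (b c : ℕ) (q : Fin c → ℝ) (hq : ∀ i, q i ∈ Set.Ioo (0 : ℝ) 1) :
    -- the `g`-measure is well defined, with the explicit normalization constant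
    Summable (gWeight b q) ∧
    gZ b q = ∏ i, (1 - q i) ^ (-(b : ℤ)) ∧
    MeasureTheory.IsProbabilityMeasure (gMeasure b q) ∧
    -- the distribution function of the first row length
    (∀ a : ℕ, (gMeasure b q).real {π | π.lambda1 ≤ a} =
      MvPolynomial.eval (Fin.append (fun _ : Fin b => (1 : ℝ)) q)
        (schurPoly (rectDiagram a b) (b + c)) / gZ b q) ∧
    -- its Toeplitz determinant expression
    (∀ a : ℕ, (gMeasure b q).real {π | π.lambda1 ≤ a} =
      (Matrix.of fun i j : Fin a => phiHat b q ((i : ℤ) - (j : ℤ))).det / gZ b q) ∧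
    -- the symbol of the Toeplitz matrix
    (∀ z : ℂ, z ≠ 0 → HasSum (fun k : ℤ => (phiHat b q k : ℂ) * z ^ k)
      ((1 + z) ^ b * ∏ i, (1 + (q i : ℂ) * z⁻¹))) := by
  refine ⟨(hasSum_gWeight b q hq).summable, gZ_eq b q hq, isProbabilityMeasure_gMeasure b q hq,
    fun a => ?_, gMeasure_real_lambda1_le b q hq, fun z hz => hasSum_phiHat_mul_zpow b q hz⟩
  rw [gMeasure_real_lambda1_le b q hq, det_phiHat_eq_eval_schurPoly]
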